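/- For a smooth immersion $F$ of the plane $\mathbb{R}^2$ into a Euclidean space, call $p,q\in\mathbb{R}^2$ equivalent if there is a local homeomorphism $\varphi$ of the plane near $p$ with $\varphi(p)=q$ and $F\circ\varphi=F$. The surface immersed by $F$ is the quotient of $\mathbb{R}^2$ by this relation, with the Riemannian metric induced by $F$. For coprime integers $r>m>0$ let $$I(u,v)=(\cos ru\cos v,\ \sin ru\cos v,\ \cos mu\sin v,\ \sin mu\sin v)\in\mathbb{S}^3\subset\mathbb{R}^4$$ be the immersion of the Lawson tau-surface $\tau_{r,m}$, and let $$I^*(u,v)=\frac{(m\sin ru\sin v,\ -m\cos ru\sin v,\ -r\sin mu\cos v,\ r\cos mu\cos v)}{\sqrt{r^2\cos^2v+m^2\sin^2v}}$$ be its unit normal in $\mathbb{S}^3$. The bipolar Lawson tau-surface $\tilde\tau_{r,m}$ is the surface immersed by $I\wedge I^*\colon\mathbb{R}^2\to\mathbb{S}^5\subset\Lambda^2\mathbb{R}^4\cong\mathbb{R}^6$. Penskoi's surface $T_{a,b,c}$, where either $a,b,c$ are integers with $|c|>\sqrt{a^2+b^2}$, or $a,b$ are nonzero integers with $|c|=\sqrt{a^2+b^2}$,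 is the surface immersed by $$(x,y)\mapsto\left(\sqrt{\tfrac{b^2+c^2-a^2}{2(c^2-a^2)}}\,e^{iax}\sin y,\ \sqrt{\tfrac{a^2+c^2-b^2}{2(c^2-b^2)}}\,e^{ibx}\cos y,\ \sqrt{\tfrac{a^2+b^2-c^2}{2(b^2-c^2)}}\,e^{icx}\sqrt{1-\tfrac{b^2-a^2}{c^2-a^2}\sin^2y}\right)\in\mathbb{S}^5\subset\mathbb{C}^3 .$$ Theorem. Let $r>m>0$ be coprime integers. 1. If $rm\equiv0\pmod 2$, then $\tilde\tau_{r,m}$ is a torus, and it is isometric to $T_{a,b,c}$ with $a=r-m$, $b=0$, $c=r+m$. 2. If $rm\equiv1\pmod 4$, then $\tilde\tau_{r,m}$ is a torus, and it is isometric to $T_{a,b,c}$ with $a=\frac{r-m}2$, $b=0$, $c=\frac{r+m}2$. 3. If $rm\equiv3\pmod 4$, then $\tilde\tau_{r,m}$ is a Klein bottle, and it is isometric to $T_{a,b,c}$ with $a=\frac{r-m}2$, $b=0$, $c=\frac{r+m}2$. In each case $(a,b,c)$ is an admissible triple of parameters of the family $T_{a,b,c}$. -/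

import Mathlib

open scoped ContDiff

noncomputable section

namespace TauSurface

/-! ### The surface carried by an immersion of the plane, and its induced metric -/

/-- `F` is a smooth immersion of the plane into the inner product space `V`. -/
def IsImmersionOfPlane {V : Type*} [NormedAddCommGroup V] [InnerProductSpace ℝ V]
    (F : ℝ × ℝ → V) : Prop :=
  ContDiff ℝ ∞ F ∧ ∀ p, Function.Injective (fderiv ℝ F p)

/-- `F` parametrizes the same sheet of its image near `p` as near `q`: there is a local
homeomorphism `φ` of the plane with `φ p = q` and `F ∘ φ = F`
(for an immersion `F` such a `φ` is automatically a local diffeomorphism).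
The immersed images considered here have self-intersections, so `F p = F q` alone does not
mean that `p` and `q` are parameters of the same point of the surface. -/
def SameSheet {V : Type*} (F : ℝ × ℝ → V) (p q : ℝ × ℝ) : Prop :=
  ∃ φ : OpenPartialHomeomorph (ℝ × ℝ) (ℝ × ℝ),
    p ∈ φ.source ∧ φ p = q ∧ ∀ x ∈ φ.source, F (φ x) = F x

theorem SameSheet.equivalence {V : Type*} (F : ℝ × ℝ → V) : Equivalence (SameSheet F) where
  refl p := ⟨OpenPartialHomeomorph.refl _, by simp, by simp, by simp⟩
  symm := by
    rintro p q ⟨φ, hp, rfl, hF⟩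
    refine ⟨φ.symm, φ.map_source hp, φ.left_inv hp, fun x hx => ?_⟩
    have h := hF _ (φ.map_target hx)
    rw [φ.right_inv hx] at h
    exact h.symm
  trans := by
    rintro p q s ⟨φ, hp, rfl, hF⟩ ⟨ψ, hq, rfl, hG⟩
    refine ⟨φ.trans ψ, by simp [hp, hq], by simp, fun x hx => ?_⟩
    rw [OpenPartialHomeomorph.trans_source] at hx
    rw [OpenPartialHomeomorph.coe_trans, Function.comp_apply, hG _ hx.2, hF _ hx.1]

/-- The equivalence relation `SameSheet F` as a setoid. -/
def sheetSetoid {V : Type*} (F : ℝ × ℝ → V) : Setoid (ℝ × ℝ) :=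
  ⟨SameSheet F, SameSheet.equivalence F⟩

/-- The (abstract) surface immersed by `F`: the quotient of the plane, with the quotient topology,
by the relation that identifies parameters of the same sheet. The map `F` descends to it. -/
abbrev Surface {V : Type*} (F : ℝ × ℝ → V) : Type :=
  Quotient (sheetSetoid F)

/-- The point of the surface with parameter `p`. For an immersion `F`, this map from the plane is
a local homeomorphism, and its local inverses are the smooth charts of the surface. -/
def pt {V : Type*} (F : ℝ × ℝ → V) (p : ℝ × ℝ) : Surface F :=
  Quotient.mk (sheetSetoid F) p

/-- The Riemannian metric induced by `F`, written in the parameters. -/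
def inducedMetric {V : Type*} [NormedAddCommGroup V] [InnerProductSpace ℝ V]
    (F : ℝ × ℝ → V) (p v w : ℝ × ℝ) : ℝ :=
  inner ℝ (fderiv ℝ F p v) (fderiv ℝ F p w)

/-- `Φ` is a Riemannian isometry for the induced metrics: a homeomorphism which, read in the
parameters, is near every point a diffeomorphism `φ` that pulls back one metric to the other. -/
def IsRiemannianIsometry {V W : Type*} [NormedAddCommGroup V] [InnerProductSpace ℝ V]
    [NormedAddCommGroup W] [InnerProductSpace ℝ W]
    (F : ℝ × ℝ → V) (G : ℝ × ℝ → W) (Φ : Surface F ≃ₜ Surface G) : Prop :=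
  ∀ p q : ℝ × ℝ, Φ (pt F p) = pt G q →
    ∃ φ : OpenPartialHomeomorph (ℝ × ℝ) (ℝ × ℝ),
      p ∈ φ.source ∧ φ p = q ∧
      ContDiffOn ℝ ∞ φ φ.source ∧ ContDiffOn ℝ ∞ φ.symm φ.target ∧
      (∀ x ∈ φ.source, Φ (pt F x) = pt G (φ x)) ∧
      (∀ x ∈ φ.source, ∀ v w : ℝ × ℝ,
        inducedMetric G (φ x) (fderiv ℝ φ x v) (fderiv ℝ φ x w) = inducedMetric F x v w)

/-- The surfaces immersed by `F` and by `G`, with their induced Riemannian metrics,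
are isometric. -/
def IsometricSurfaces {V W : Type*} [NormedAddCommGroup V] [InnerProductSpace ℝ V]
    [NormedAddCommGroup W] [InnerProductSpace ℝ W]
    (F : ℝ × ℝ → V) (G : ℝ × ℝ → W) : Prop :=
  IsImmersionOfPlane F ∧ IsImmersionOfPlane G ∧
    ∃ Φ : Surface F ≃ₜ Surface G, IsRiemannianIsometry F G Φ

/-! ### Topological types -/

/-- The equivalence relation on the plane generated by `(x, y) ∼ (x + 1, -y)` and
`(x, y) ∼ (x, y + 1)`. -/
def kleinSetoid : Setoid (ℝ × ℝ) where
  r p q := ∃ k l : ℤ, q = (p.1 + k, (-1 : ℝ) ^ k * p.2 + l)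
  iseqv :=
    { refl := fun p => ⟨0, 0, by simp⟩
      symm := by
        rintro p q ⟨k, l, rfl⟩
        rcases Int.even_or_odd k with hk | hk
        · refine ⟨-k, -l, ?_⟩
          ext
          · push_cast; ring
          · simp only [hk.neg.neg_one_zpow, hk.neg_one_zpow]; push_cast; ring
        · refine ⟨-k, l, ?_⟩
          ext
          · push_cast; ring
          · simp only [hk.neg.neg_one_zpow, hk.neg_one_zpow]; ring
      trans := by
        rintro p q s ⟨k, l, rfl⟩ ⟨k', l', rfl⟩
        rcases Int.even_or_odd k' with hk | hk
        · refine ⟨k + k', l + l', ?_⟩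
          ext
          · push_cast; ring
          · simp only [zpow_add₀ (show (-1 : ℝ) ≠ 0 by norm_num), hk.neg_one_zpow]
            push_cast; ring
        · refine ⟨k + k', -l + l', ?_⟩
          ext
          · push_cast; ring
          · simp only [zpow_add₀ (show (-1 : ℝ) ≠ 0 by norm_num), hk.neg_one_zpow]
            push_cast; ring }

/-- The Klein bottle. -/
abbrev KleinBottle : Type := Quotient kleinSetoid

/-- The surface immersed by `F` is a torus. -/
def IsTorus {V : Type*} (F : ℝ × ℝ → V) : Prop :=
  Nonempty (Surface F ≃ₜ UnitAddCircle × UnitAddCircle)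

/-- The surface immersed by `F` is a Klein bottle. -/
def IsKleinBottle {V : Type*} (F : ℝ × ℝ → V) : Prop :=
  Nonempty (Surface F ≃ₜ KleinBottle)

/-! ### Bipolar Lawson tau-surfaces -/

/-- The immersion of the Lawson tau-surface with parameters `r`, `m` into the unit sphere of
`ℝ⁴`. -/
def lawson (r m : ℝ) (p : ℝ × ℝ) : EuclideanSpace ℝ (Fin 4) :=
  !₂[Real.cos (r * p.1) * Real.cos p.2, Real.sin (r * p.1) * Real.cos p.2,
    Real.cos (m * p.1) * Real.sin p.2, Real.sin (m * p.1) * Real.sin p.2]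

/-- The unit vector normal to the Lawson tau-surface and tangent to the unit sphere of `ℝ⁴`. -/
def lawsonNormal (r m : ℝ) (p : ℝ × ℝ) : EuclideanSpace ℝ (Fin 4) :=
  (√(r ^ 2 * Real.cos p.2 ^ 2 + m ^ 2 * Real.sin p.2 ^ 2))⁻¹ •
    !₂[m * Real.sin (r * p.1) * Real.sin p.2, -(m * Real.cos (r * p.1) * Real.sin p.2),
      -(r * Real.sin (m * p.1) * Real.cos p.2), r * Real.cos (m * p.1) * Real.cos p.2]

/-- The exterior product of two vectors of `ℝ⁴`, in the orthonormal basis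
`e₁∧e₂, e₃∧e₄, e₁∧e₃, e₂∧e₄, e₂∧e₃, e₁∧e₄` of `Λ²ℝ⁴ ≅ ℝ⁶`. -/
def wedge (x y : EuclideanSpace ℝ (Fin 4)) : EuclideanSpace ℝ (Fin 6) :=
  !₂[x 0 * y 1 - x 1 * y 0, x 2 * y 3 - x 3 * y 2, x 0 * y 2 - x 2 * y 0,
    x 1 * y 3 - x 3 * y 1, x 1 * y 2 - x 2 * y 1, x 0 * y 3 - x 3 * y 0]

/-- The immersion of the bipolar Lawson tau-surface with parameters `r`, `m` into the unit sphere
of `Λ²ℝ⁴ ≅ ℝ⁶`. -/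
def bipolarLawson (r m : ℝ) (p : ℝ × ℝ) : EuclideanSpace ℝ (Fin 6) :=
  wedge (lawson r m p) (lawsonNormal r m p)

/-! ### Penskoi's family -/

/-- The parameters `(a, b, c)` of the members of Penskoi's family. -/
def IsPenskoiTriple (a b c : ℝ) : Prop :=
  (∃ i j k : ℤ, a = i ∧ b = j ∧ c = k ∧ √(a ^ 2 + b ^ 2) < |c|) ∨
  (∃ i j : ℤ, i ≠ 0 ∧ j ≠ 0 ∧ a = i ∧ b = j ∧ |c| = √(a ^ 2 + b ^ 2))

/-- The immersion of Penskoi's surface with parameters `(a, b, c)` into the unit sphere of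
`ℂ³ ≅ ℝ⁶`. -/
def penskoi (a b c : ℝ) (p : ℝ × ℝ) : EuclideanSpace ℂ (Fin 3) :=
  !₂[(√((b ^ 2 + c ^ 2 - a ^ 2) / (2 * (c ^ 2 - a ^ 2))) : ℂ) *
        Complex.exp (Complex.I * (a * p.1 : ℝ)) * (Real.sin p.2 : ℂ),
    (√((a ^ 2 + c ^ 2 - b ^ 2) / (2 * (c ^ 2 - b ^ 2))) : ℂ) *
        Complex.exp (Complex.I * (b * p.1 : ℝ)) * (Real.cos p.2 : ℂ),
    (√((a ^ 2 + b ^ 2 - c ^ 2) / (2 * (b ^ 2 - c ^ 2))) : ℂ) *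
        Complex.exp (Complex.I * (c * p.1 : ℝ)) *
        (√(1 - (b ^ 2 - a ^ 2) / (c ^ 2 - a ^ 2) * Real.sin p.2 ^ 2) : ℂ)]

end TauSurface

end

noncomputable section

namespace TauSurface

/-! ### Surfaces as quotients by a group of deck transformations -/

open Topology

/-! The two immersions are congruent. The coordinates of `I ∧ I*` are products of functions of `v`
with waves of frequency `r - m`, `0` and `r + m` in `u`. A linear isometry of `Λ²ℝ⁴` onto `ℂ³`
separates these frequencies, and the substitution `x = k u`, `y = penskoiAngle r m v` turns the
result into Penskoi's immersion with `a = (r - m) / k`, `b = 0`, `c = (r + m) / k`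
(`bivectorToComplex_bipolarLawson`). Here `k = 1` if `rm` is even and `k = 2` if `rm` is odd, so
that `a` and `c` are coprime integers.

The topology is then read off from `penskoi a 0 c`. Off the curves `sin y = 0`, Bézout for `a, c`
shows that two parameters have the same image only if they differ by a translation in `(2πℤ)²` or,
when `c` is even, by a glide reflection generated from `(x, y) ↦ (x + π, -y)` (`rel_of_penskoi_eq`).
On `sin y = 0` there may be further coincidences, but these do not extend to nearby sheets: the
relations are closed and the remaining parameters are dense (`SameSheet.of_dense`). The quotient is
therefore a torus for odd `c` and a Klein bottle for even `c`. For `k = 2`, `rm = c² - a²`, and its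
residue mod 4 gives the parity of `c`; for `k = 1`, `c = r + m` is odd. -/

theorem exists_homeomorph_quotient {X Y : Type*} [TopologicalSpace X] [TopologicalSpace Y]
    (s : Setoid X) {f : X → Y} (hf : IsQuotientMap f) (h : ∀ p q, s p q ↔ f p = f q) :
    ∃ Φ : Quotient s ≃ₜ Y, ∀ x, Φ (Quotient.mk s x) = f x := by
  obtain rfl : s = Setoid.ker f := Setoid.ext h
  exact ⟨IsQuotientMap.homeomorph (f := ⟨f, hf.continuous⟩) hf, fun x => rfl⟩

theorem pt_eq_pt_iff {V : Type*} {F : ℝ × ℝ → V} {p q : ℝ × ℝ} :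
    pt F p = pt F q ↔ SameSheet F p q :=
  Quotient.eq (r := sheetSetoid F)

theorem SameSheet.of_homeomorph {V : Type*} {F : ℝ × ℝ → V} {p q : ℝ × ℝ}
    (γ : (ℝ × ℝ) ≃ₜ (ℝ × ℝ)) (hpq : γ p = q) (hγ : ∀ x, F (γ x) = F x) : SameSheet F p q :=
  ⟨γ.toOpenPartialHomeomorph, by simp, by simpa using hpq, fun x _ => by simpa using hγ x⟩

/-- A closed relation that contains all coincidences of `F` over a dense set of parameters
contains `SameSheet F`. -/
theorem SameSheet.of_dense {V : Type*} {F : ℝ × ℝ → V} {R : ℝ × ℝ → ℝ × ℝ → Prop}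
    (hR : IsClosed {z : (ℝ × ℝ) × (ℝ × ℝ) | R z.1 z.2}) {D : Set (ℝ × ℝ)} (hD : Dense D)
    (hF : ∀ p ∈ D, ∀ q, F p = F q → R p q) {p q : ℝ × ℝ} (h : SameSheet F p q) : R p q := by
  obtain ⟨φ, hp, rfl, hφ⟩ := h
  have hcl : p ∈ closure (φ.source ∩ D) :=
    hD.open_subset_closure_inter φ.open_source hp
  -- The pair `(p, φ p)` is a limit of pairs `(x, φ x)` with `x ∈ D`, for which `R` holds by `hF`.
  have hcont : ContinuousWithinAt (fun x => (x, φ x)) (φ.source ∩ D) p :=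
    continuousWithinAt_id.prodMk
      ((φ.continuousAt hp).continuousWithinAt)
  have hmem := hcont.mem_closure_image hcl
  have hsub : (fun x => (x, φ x)) '' (φ.source ∩ D) ⊆ {z : (ℝ × ℝ) × (ℝ × ℝ) | R z.1 z.2} := by
    rintro _ ⟨x, ⟨hx, hxD⟩, rfl⟩
    exact hF x hxD _ (hφ x hx).symm
  exact closure_minimal hsub hR hmem

/-- Local homeomorphisms are conjugated by `Ψ`. Injectivity of `L` serves to pull coincidences of
`G` back to `F`. -/
theorem sameSheet_comp_iff {V W : Type*} {F : ℝ × ℝ → V} {G : ℝ × ℝ → W}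
    (Ψ : (ℝ × ℝ) ≃ₜ (ℝ × ℝ)) {L : V → W} (hL : Function.Injective L)
    (h : ∀ p, L (F p) = G (Ψ p)) (p q : ℝ × ℝ) :
    SameSheet F p q ↔ SameSheet G (Ψ p) (Ψ q) := by
  constructor
  · rintro ⟨φ, hp, rfl, hφ⟩
    refine ⟨Ψ.symm.toOpenPartialHomeomorph.trans (φ.trans Ψ.toOpenPartialHomeomorph),
      by simpa using hp, by simp, fun x hx => ?_⟩
    have hx' : Ψ.symm x ∈ φ.source := by simpa using hx
    simpa [h] using congrArg L (hφ _ hx')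
  · rintro ⟨φ, hp, hq, hφ⟩
    refine ⟨Ψ.toOpenPartialHomeomorph.trans (φ.trans Ψ.symm.toOpenPartialHomeomorph),
      by simpa using hp, by simp [hq], fun x hx => hL ?_⟩
    have hx' : Ψ x ∈ φ.source := by simpa using hx
    simpa [h] using hφ _ hx'

/-! ### Linear isometries of the target and the induced metric. -/

section Isometry

variable {V W : Type*} [NormedAddCommGroup V] [InnerProductSpace ℝ V]
  [NormedAddCommGroup W] [InnerProductSpace ℝ W]

theorem linearIsometry_fderiv {F : ℝ × ℝ → V} {G : ℝ × ℝ → W} (L : V →ₗᵢ[ℝ] W)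
    {φ : ℝ × ℝ → ℝ × ℝ} (hF : Differentiable ℝ F) (hG : Differentiable ℝ G)
    (hφ : Differentiable ℝ φ) (h : ∀ p, L (F p) = G (φ p)) (p v : ℝ × ℝ) :
    L (fderiv ℝ F p v) = fderiv ℝ G (φ p) (fderiv ℝ φ p v) := by
  have h1 : HasFDerivAt (fun p => L (F p)) (L.toContinuousLinearMap.comp (fderiv ℝ F p)) p :=
    L.toContinuousLinearMap.hasFDerivAt.comp p (hF p).hasFDerivAt
  have h2 : HasFDerivAt (fun p => G (φ p)) ((fderiv ℝ G (φ p)).comp (fderiv ℝ φ p)) p :=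
    (hG (φ p)).hasFDerivAt.comp p (hφ p).hasFDerivAt
  rw [funext h] at h1
  exact DFunLike.congr_fun (h1.unique h2) v

theorem inducedMetric_comp {F : ℝ × ℝ → V} {G : ℝ × ℝ → W} (L : V →ₗᵢ[ℝ] W)
    {φ : ℝ × ℝ → ℝ × ℝ} (hF : Differentiable ℝ F) (hG : Differentiable ℝ G)
    (hφ : Differentiable ℝ φ) (h : ∀ p, L (F p) = G (φ p)) (p v w : ℝ × ℝ) :
    inducedMetric G (φ p) (fderiv ℝ φ p v) (fderiv ℝ φ p w) = inducedMetric F p v w := by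
  simp only [inducedMetric, ← linearIsometry_fderiv L hF hG hφ h, L.inner_map_map]

theorem injective_fderiv_of_inverse {φ ψ : ℝ × ℝ → ℝ × ℝ} (hφ : Differentiable ℝ φ)
    (hψ : Differentiable ℝ ψ) (h : ∀ p, ψ (φ p) = p) (p : ℝ × ℝ) :
    Function.Injective (fderiv ℝ φ p) := by
  have h1 : HasFDerivAt (fun p => ψ (φ p)) ((fderiv ℝ ψ (φ p)).comp (fderiv ℝ φ p)) p :=
    (hψ (φ p)).hasFDerivAt.comp p (hφ p).hasFDerivAt
  rw [funext h] at h1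
  refine Function.LeftInverse.injective (g := fderiv ℝ ψ (φ p)) fun v => ?_
  exact DFunLike.congr_fun (h1.unique (hasFDerivAt_id p)) v

/-- By the chain rule `L ∘ dF = dG ∘ dΨ`, and both factors on the right are injective. -/
theorem IsImmersionOfPlane.of_comp {F : ℝ × ℝ → V} {G : ℝ × ℝ → W} (hG : IsImmersionOfPlane G)
    (L : V ≃ₗᵢ[ℝ] W) (Ψ : (ℝ × ℝ) ≃ₜ (ℝ × ℝ)) (hΨ : ContDiff ℝ ∞ Ψ) (hΨ' : ContDiff ℝ ∞ Ψ.symm)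
    (h : ∀ p, L (F p) = G (Ψ p)) : IsImmersionOfPlane F := by
  have hF : ContDiff ℝ ∞ F := by
    have : F = fun p => L.symm (G (Ψ p)) := by
      funext p
      rw [← h, L.symm_apply_apply]
    rw [this]
    exact L.symm.contDiff.comp (hG.1.comp hΨ)
  refine ⟨hF, fun p v w hvw => ?_⟩
  have key := linearIsometry_fderiv L.toLinearIsometry (hF.differentiable (by simp))
    (hG.1.differentiable (by simp)) (hΨ.differentiable (by simp)) h p
  have := (key v).symm.trans ((congrArg L hvw).trans (key w))
  exact injective_fderiv_of_inverse (hΨ.differentiable (by simp)) (hΨ'.differentiable (by simp))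
    Ψ.symm_apply_apply p (hG.2 _ this)

/-- The surfaces immersed by `F` and by `G` are homeomorphic and isometric if `F` is carried to `G`
by a linear isometry of the target and a diffeomorphism of the plane, and the parameters of the
same sheet of `G` are related by deck diffeomorphisms of the plane. -/
theorem isometricSurfaces_of_comp {F : ℝ × ℝ → V} {G : ℝ × ℝ → W} (hG : IsImmersionOfPlane G)
    (L : V ≃ₗᵢ[ℝ] W) (Ψ : (ℝ × ℝ) ≃ₜ (ℝ × ℝ)) (hΨ : ContDiff ℝ ∞ Ψ) (hΨ' : ContDiff ℝ ∞ Ψ.symm)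
    (h : ∀ p, L (F p) = G (Ψ p))
    (hdeck : ∀ p q, SameSheet G p q → ∃ γ : (ℝ × ℝ) ≃ₜ (ℝ × ℝ), γ p = q ∧ (∀ x, G (γ x) = G x) ∧
      ContDiff ℝ ∞ γ ∧ ContDiff ℝ ∞ γ.symm) :
    IsometricSurfaces F G := by
  have hF := hG.of_comp L Ψ hΨ hΨ' h
  have hquot : IsQuotientMap (fun p => pt G (Ψ p)) :=
    isQuotientMap_quotient_mk'.comp Ψ.isQuotientMap
  obtain ⟨Φ, hΦ⟩ := exists_homeomorph_quotient (sheetSetoid F) hquot fun p q => by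
    rw [pt_eq_pt_iff]
    exact sameSheet_comp_iff Ψ L.injective h p q
  refine ⟨hF, hG, Φ, fun p q hpq => ?_⟩
  have hΦ' : ∀ x, Φ (pt F x) = pt G (Ψ x) := hΦ
  rw [hΦ', pt_eq_pt_iff] at hpq
  -- So far `Ψ p` and `q` only share a sheet of `G`; following `Ψ` by a deck map `γ` sends `p`
  -- exactly to `q`.
  obtain ⟨γ, hγ, hGγ, hγ1, hγ2⟩ := hdeck _ _ hpq
  refine ⟨(Ψ.trans γ).toOpenPartialHomeomorph, by simp, by simpa using hγ,
    ?_, ?_, fun x _ => ?_, fun x _ v w => ?_⟩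
  · exact (hγ1.comp hΨ).contDiffOn
  · exact (hΨ'.comp hγ2).contDiffOn
  · rw [hΦ', pt_eq_pt_iff]
    exact SameSheet.of_homeomorph γ (by simp) hGγ
  · exact inducedMetric_comp L.toLinearIsometry (hF.1.differentiable (by simp))
      (hG.1.differentiable (by simp)) ((hγ1.comp hΨ).differentiable (by simp))
      (fun p => by simp [h, hGγ]) x v w

end Isometry

/-! ### Lattices and glide reflections of the plane -/

open Real

/-- The map `(x, y) ↦ (x + s, ε y + t)`, where `ε` is a sign. -/
def glide (ε : ℤˣ) (s t : ℝ) : (ℝ × ℝ) ≃ₜ (ℝ × ℝ) where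
  toFun p := (p.1 + s, ((ε : ℤ) : ℝ) * p.2 + t)
  invFun p := (p.1 - s, ((ε : ℤ) : ℝ) * (p.2 - t))
  left_inv p := by
    rcases Int.units_eq_one_or ε with rfl | rfl <;> ext <;> simp
  right_inv p := by
    rcases Int.units_eq_one_or ε with rfl | rfl <;> ext <;> simp

theorem glide_apply (ε : ℤˣ) (s t : ℝ) (p : ℝ × ℝ) :
    glide ε s t p = (p.1 + s, ((ε : ℤ) : ℝ) * p.2 + t) := rfl

theorem contDiff_glide (ε : ℤˣ) (s t : ℝ) : ContDiff ℝ ∞ (glide ε s t) := by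
  change ContDiff ℝ ∞ fun p : ℝ × ℝ => (p.1 + s, ((ε : ℤ) : ℝ) * p.2 + t)
  fun_prop

theorem contDiff_glide_symm (ε : ℤˣ) (s t : ℝ) : ContDiff ℝ ∞ (glide ε s t).symm := by
  change ContDiff ℝ ∞ fun p : ℝ × ℝ => (p.1 - s, ((ε : ℤ) : ℝ) * (p.2 - t))
  fun_prop

/-- `q` is obtained from `p` by a translation in `(2πℤ)²`. -/
def TorusRel (p q : ℝ × ℝ) : Prop :=
  ∃ k l : ℤ, q = (p.1 + 2 * π * k, p.2 + 2 * π * l)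

/-- `q` is obtained from `p` by a glide reflection along an odd multiple of `π`. -/
def GlideRel (p q : ℝ × ℝ) : Prop :=
  ∃ k l : ℤ, q = (p.1 + π * (2 * k + 1), -p.2 + 2 * π * l)

theorem isClosed_torusRel : IsClosed {z : (ℝ × ℝ) × (ℝ × ℝ) | TorusRel z.1 z.2} := by
  have hπ := Real.pi_pos
  have hZ := Int.isClosedEmbedding_coe_real.isClosed_range
  have h1 : IsClosed {z : (ℝ × ℝ) × (ℝ × ℝ) | (z.2.1 - z.1.1) / (2 * π) ∈ Set.range Int.cast} :=
    hZ.preimage (by fun_prop)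
  have h2 : IsClosed {z : (ℝ × ℝ) × (ℝ × ℝ) | (z.2.2 - z.1.2) / (2 * π) ∈ Set.range Int.cast} :=
    hZ.preimage (by fun_prop)
  convert h1.inter h2 using 1
  ext ⟨⟨x, y⟩, ⟨x', y'⟩⟩
  constructor
  · rintro ⟨k, l, h⟩
    simp only [Prod.mk.injEq] at h
    exact ⟨⟨k, by simp only [h.1]; field_simp; ring⟩, ⟨l, by simp only [h.2]; field_simp; ring⟩⟩
  · rintro ⟨⟨k, hk⟩, ⟨l, hl⟩⟩
    refine ⟨k, l, ?_⟩
    simp only at hk hl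
    field_simp at hk hl
    ext <;> simp <;> linarith

theorem isClosed_glideRel : IsClosed {z : (ℝ × ℝ) × (ℝ × ℝ) | GlideRel z.1 z.2} := by
  -- Undoing one basic glide on the second point leaves a lattice translation; the reflection
  -- changes the sign of `l`.
  have hc : Continuous fun z : (ℝ × ℝ) × (ℝ × ℝ) =>
      ((z.1, (z.2.1 - π, -z.2.2)) : (ℝ × ℝ) × (ℝ × ℝ)) := by fun_prop
  convert isClosed_torusRel.preimage hc using 1
  ext ⟨⟨x, y⟩, ⟨x', y'⟩⟩
  constructor
  · rintro ⟨k, l, h⟩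
    simp only [Prod.mk.injEq] at h
    refine ⟨k, -l, ?_⟩
    ext <;> simp [h.1, h.2] <;> ring
  · rintro ⟨k, l, h⟩
    simp only [Prod.mk.injEq] at h
    refine ⟨k, -l, ?_⟩
    ext <;> simp <;> linarith [h.1, h.2]

/-- A surface whose deck group is the lattice `(2πℤ)²` is a torus. -/
theorem isTorus_of_sameSheet_iff {V : Type*} {F : ℝ × ℝ → V}
    (h : ∀ p q, SameSheet F p q ↔ TorusRel p q) : IsTorus F := by
  have hπ := Real.pi_pos
  let c : ℝ ≃ₜ ℝ := Homeomorph.mulLeft₀ (2 * π)⁻¹ (by positivity)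
  have hq : IsOpenQuotientMap (fun x : ℝ => (x : UnitAddCircle)) :=
    QuotientAddGroup.isOpenQuotientMap_mk
  have hq1 : IsOpenQuotientMap (fun x : ℝ => ((c x : ℝ) : UnitAddCircle)) :=
    hq.comp c.isOpenQuotientMap
  have key : ∀ x x' : ℝ, ((c x : ℝ) : UnitAddCircle) = (c x' : ℝ) ↔
      ∃ k : ℤ, x' = x + 2 * π * k := by
    intro x x'
    rw [eq_comm, ← sub_eq_zero, ← AddCircle.coe_sub, AddCircle.coe_eq_zero_iff]
    simp only [c, Homeomorph.coe_mulLeft₀, zsmul_eq_mul, mul_one]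
    refine exists_congr fun k => ⟨fun hk => ?_, fun hk => ?_⟩
    · field_simp at hk
      linarith
    · rw [hk]
      field_simp
      ring
  obtain ⟨Φ, -⟩ := exists_homeomorph_quotient (sheetSetoid F) (hq1.prodMap hq1).isQuotientMap
    fun p q => by
      refine (h p q).trans ?_
      simp only [Prod.map, Prod.mk.injEq, key]
      constructor
      · rintro ⟨k, l, rfl⟩
        exact ⟨⟨k, rfl⟩, ⟨l, rfl⟩⟩
      · rintro ⟨⟨k, hk⟩, ⟨l, hl⟩⟩
        exact ⟨k, l, Prod.ext hk hl⟩
  exact ⟨Φ⟩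

/-- A surface whose deck group is generated by `(2πℤ)²` and `(x, y) ↦ (x + π, -y)`
is a Klein bottle. -/
theorem isKleinBottle_of_sameSheet_iff {V : Type*} {F : ℝ × ℝ → V}
    (h : ∀ p q, SameSheet F p q ↔ TorusRel p q ∨ GlideRel p q) : IsKleinBottle F := by
  have hπ := Real.pi_pos
  -- The horizontal unit is `π`, the length of the glide, so lattice translations become the even
  -- values of `k` in `kleinSetoid` and glides the odd ones.
  let c : (ℝ × ℝ) ≃ₜ (ℝ × ℝ) := (Homeomorph.mulLeft₀ π⁻¹ (by positivity)).prodCongr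
    (Homeomorph.mulLeft₀ (2 * π)⁻¹ (by positivity))
  have hc : ∀ p, c p = (π⁻¹ * p.1, (2 * π)⁻¹ * p.2) := fun p => rfl
  have hq : IsQuotientMap (fun p => Quotient.mk kleinSetoid (c p)) :=
    isQuotientMap_quotient_mk'.comp c.isQuotientMap
  obtain ⟨Φ, -⟩ := exists_homeomorph_quotient (sheetSetoid F) hq fun p q => by
    refine (h p q).trans ?_
    rw [Quotient.eq]
    change _ ↔ ∃ k l : ℤ, c q = ((c p).1 + k, (-1 : ℝ) ^ k * (c p).2 + l)
    simp only [hc]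
    constructor
    · rintro (⟨k, l, rfl⟩ | ⟨k, l, rfl⟩)
      · refine ⟨2 * k, l, ?_⟩
        rw [(even_two_mul k).neg_one_zpow]
        ext <;> simp <;> field_simp
      · refine ⟨2 * k + 1, l, ?_⟩
        rw [(odd_two_mul_add_one k).neg_one_zpow]
        ext <;> simp <;> field_simp
    · rintro ⟨k, l, hkl⟩
      simp only [Prod.mk.injEq] at hkl
      obtain ⟨h1, h2⟩ := hkl
      rcases Int.even_or_odd' k with ⟨j, rfl | rfl⟩
      · rw [(even_two_mul j).neg_one_zpow] at h2
        left
        refine ⟨j, l, ?_⟩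
        push_cast at h1
        field_simp at h1 h2
        ext <;> simp <;> linarith
      · rw [(odd_two_mul_add_one j).neg_one_zpow] at h2
        right
        refine ⟨j, l, ?_⟩
        push_cast at h1
        field_simp at h1 h2
        ext <;> simp <;> linarith
  exact ⟨Φ⟩

/-! ### Penskoi's surfaces with `b = 0` -/

/-- The modulus of the third coordinate of `penskoi a 0 c`. -/
def penskoiRadius (a c y : ℝ) : ℝ :=
  √((a ^ 2 - c ^ 2) / (2 * (-c ^ 2))) * √(1 + a ^ 2 / (c ^ 2 - a ^ 2) * sin y ^ 2)

theorem penskoi_zero_apply_zero {a c : ℝ} (hac : a ^ 2 < c ^ 2) (p : ℝ × ℝ) :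
    penskoi a 0 c p 0 = ((√2)⁻¹ : ℝ) * Complex.exp (Complex.I * (a * p.1 : ℝ)) * (sin p.2 : ℂ) := by
  have h : (0 ^ 2 + c ^ 2 - a ^ 2) / (2 * (c ^ 2 - a ^ 2)) = (2 : ℝ)⁻¹ := by
    have : c ^ 2 - a ^ 2 ≠ 0 := by linarith
    field_simp
    ring
  simp only [penskoi]
  rw [h, Real.sqrt_inv]
  rfl

theorem penskoi_zero_apply_one (a c : ℝ) (p : ℝ × ℝ) :
    penskoi a 0 c p 1 = ((√((a ^ 2 + c ^ 2) / (2 * c ^ 2)) * cos p.2 : ℝ) : ℂ) := by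
  simp [penskoi]

theorem penskoi_zero_apply_two (a c : ℝ) (p : ℝ × ℝ) :
    penskoi a 0 c p 2 =
      Complex.exp (Complex.I * (c * p.1 : ℝ)) * (penskoiRadius a c p.2 : ℝ) := by
  have h1 : (0 ^ 2 - a ^ 2) / (c ^ 2 - a ^ 2) = - (a ^ 2 / (c ^ 2 - a ^ 2)) := by ring
  have h2 : a ^ 2 + 0 ^ 2 - c ^ 2 = a ^ 2 - c ^ 2 := by ring
  have h3 : (0 : ℝ) ^ 2 - c ^ 2 = - c ^ 2 := by ring
  have h4 : 1 - -(a ^ 2 / (c ^ 2 - a ^ 2)) * sin p.2 ^ 2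
    = 1 + a ^ 2 / (c ^ 2 - a ^ 2) * sin p.2 ^ 2 := by ring
  simp only [penskoi, penskoiRadius]
  simp only [Matrix.cons_val]
  rw [h1, h2, h3, h4]
  push_cast
  ring

theorem penskoiRadius_radicand_pos {a c : ℝ} (hac : a ^ 2 < c ^ 2) (y : ℝ) :
    0 < 1 + a ^ 2 / (c ^ 2 - a ^ 2) * sin y ^ 2 := by
  have : 0 < c ^ 2 - a ^ 2 := by linarith
  positivity

theorem penskoiRadius_pos {a c : ℝ} (hac : a ^ 2 < c ^ 2) (y : ℝ) : 0 < penskoiRadius a c y := by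
  have h1 : 0 < c ^ 2 := (sq_nonneg a).trans_lt hac
  have h2 : 0 < (a ^ 2 - c ^ 2) / (2 * (-c ^ 2)) := by
    apply div_pos_of_neg_of_neg <;> linarith
  exact mul_pos (sqrt_pos.2 h2) (sqrt_pos.2 (penskoiRadius_radicand_pos hac y))

theorem contDiff_penskoiRadius {a c : ℝ} (hac : a ^ 2 < c ^ 2) :
    ContDiff ℝ ∞ (penskoiRadius a c) := by
  unfold penskoiRadius
  refine contDiff_const.mul (ContDiff.sqrt ?_ fun y => (penskoiRadius_radicand_pos hac y).ne')
  fun_prop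

theorem penskoiRadius_congr {a c y y' : ℝ} (h : sin y ^ 2 = sin y' ^ 2) :
    penskoiRadius a c y = penskoiRadius a c y' := by
  rw [penskoiRadius, penskoiRadius, h]

theorem contDiff_penskoi {a c : ℝ} (hac : a ^ 2 < c ^ 2) : ContDiff ℝ ∞ (penskoi a 0 c) := by
  have hof : ContDiff ℝ ∞ (fun x : ℝ => (x : ℂ)) := Complex.ofRealCLM.contDiff
  have hexp : ContDiff ℝ ∞ Complex.exp := (Complex.contDiff_exp (𝕜 := ℂ)).restrict_scalars ℝ
  have hmul : ∀ b : ℝ, ContDiff ℝ ∞ fun p : ℝ × ℝ =>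
      Complex.exp (Complex.I * (b * p.1 : ℝ)) := fun b =>
    hexp.comp (contDiff_const.mul (hof.comp (contDiff_const.mul contDiff_fst)))
  refine contDiff_piLp' 2 fun i => ?_
  fin_cases i
  · simp only [Fin.zero_eta, penskoi_zero_apply_zero hac]
    exact (contDiff_const.mul (hmul a)).mul (hof.comp (contDiff_sin.comp contDiff_snd))
  · simp only [Fin.mk_one, penskoi_zero_apply_one]
    exact hof.comp (contDiff_const.mul (contDiff_cos.comp contDiff_snd))
  · simp only [Fin.reduceFinMk, penskoi_zero_apply_two]
    exact (hmul c).mul (hof.comp ((contDiff_penskoiRadius hac).comp contDiff_snd))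

theorem hasDerivAt_exp_I_mul_line (b x s : ℝ) :
    HasDerivAt (fun t : ℝ => Complex.exp (Complex.I * (b * (x + t * s) : ℝ)))
      (Complex.exp (Complex.I * (b * x : ℝ)) * (Complex.I * (b * s : ℝ))) 0 := by
  have h1 : HasDerivAt (fun t : ℝ => b * (x + t * s)) (b * s) 0 := by
    simpa using (((hasDerivAt_id (0 : ℝ)).mul_const s).const_add x).const_mul b
  simpa using (h1.ofReal_comp.const_mul Complex.I).cexp

/-- Let `(s, t)` be in the kernel. The derivative of the third coordinate, divided by its phase, has
imaginary part `c s` times the positive radius, so `s = 0`. The first two coordinates then give `t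
cos y = 0` and `t sin y = 0`. -/
theorem isImmersionOfPlane_penskoi {a c : ℝ} (hac : a ^ 2 < c ^ 2) :
    IsImmersionOfPlane (penskoi a 0 c) := by
  have hc : 0 < c ^ 2 := (sq_nonneg a).trans_lt hac
  have hc0 : c ≠ 0 := by rintro rfl; simp at hc
  have hsm := contDiff_penskoi hac
  refine ⟨hsm, fun p => (injective_iff_map_eq_zero _).2 fun v hv => ?_⟩
  obtain ⟨x, y⟩ := p
  obtain ⟨s, t⟩ := v
  have hline : HasDerivAt (fun τ : ℝ => ((x + τ * s, y + τ * t) : ℝ × ℝ)) (s, t) 0 := by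
    simpa using (((hasDerivAt_id (0 : ℝ)).mul_const s).const_add x).prodMk
      (((hasDerivAt_id (0 : ℝ)).mul_const t).const_add y)
  have hlineY : HasDerivAt (fun τ : ℝ => y + τ * t) t 0 := by
    simpa using ((hasDerivAt_id (0 : ℝ)).mul_const t).const_add y
  have hG : HasFDerivAt (penskoi a 0 c) (fderiv ℝ (penskoi a 0 c) (x, y))
      (x + (0 : ℝ) * s, y + (0 : ℝ) * t) := by
    simpa using (hsm.differentiable (by simp) (x, y)).hasFDerivAt
  have hcomp := hG.comp_hasDerivAt (0 : ℝ) hline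
  rw [hv] at hcomp
  have hcoord : ∀ i, HasDerivAt (fun τ : ℝ => penskoi a 0 c (x + τ * s, y + τ * t) i) 0 0 := by
    intro i
    exact ((PiLp.proj (𝕜 := ℝ) 2 (fun _ : Fin 3 => ℂ) i).hasFDerivAt.comp_hasDerivAt
      (0 : ℝ) hcomp).congr_deriv (by simp)
  have h0 := hcoord 0
  have h1 := hcoord 1
  have h2 := hcoord 2
  simp only [penskoi_zero_apply_zero hac, penskoi_zero_apply_one, penskoi_zero_apply_two]
    at h0 h1 h2
  have hs : s = 0 := by
    have hE : HasDerivAt (fun τ : ℝ => ((penskoiRadius a c (y + τ * t) : ℝ) : ℂ))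
        ((deriv (penskoiRadius a c) y * t : ℝ) : ℂ) 0 := by
      have := ((contDiff_penskoiRadius hac).differentiable (by simp) y).hasDerivAt
      rw [show y = y + 0 * t by ring] at this
      simpa using (this.comp (0 : ℝ) hlineY).ofReal_comp
    have := ((hasDerivAt_exp_I_mul_line c x s).mul hE).unique h2
    simp only [zero_mul, add_zero, mul_assoc, ← mul_add] at this
    have := congrArg Complex.im ((mul_eq_zero.1 this).resolve_left (Complex.exp_ne_zero _))
    simpa [(penskoiRadius_pos hac y).ne', hc0] using this
  subst hs
  have hsin : t * cos y = 0 := by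
    have hE : HasDerivAt (fun τ : ℝ => ((sin (y + τ * t) : ℝ) : ℂ)) ((cos y * t : ℝ) : ℂ) 0 := by
      simpa using hlineY.sin.ofReal_comp
    have := (((hasDerivAt_exp_I_mul_line a x 0).const_mul (((√2)⁻¹ : ℝ) : ℂ)).mul hE).unique h0
    simpa [or_comm, ← Complex.ofReal_cos] using this
  have hcos : t * sin y = 0 := by
    have hE : HasDerivAt (fun τ : ℝ => ((√((a ^ 2 + c ^ 2) / (2 * c ^ 2)) * cos (y + τ * t) : ℝ) : ℂ))
        ((√((a ^ 2 + c ^ 2) / (2 * c ^ 2)) * (-sin y * t) : ℝ) : ℂ) 0 := by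
      simpa using (hlineY.cos.const_mul (√((a ^ 2 + c ^ 2) / (2 * c ^ 2)))).ofReal_comp
    have := hE.unique h1
    have hB : √((a ^ 2 + c ^ 2) / (2 * c ^ 2)) ≠ 0 := (sqrt_pos.2 (by positivity)).ne'
    rw [Complex.ofReal_eq_zero, mul_eq_zero] at this
    linarith [this.resolve_left hB]
  have ht : t = 0 := by
    have := sin_sq_add_cos_sq y
    have h3 : t = t * sin y * sin y + t * cos y * cos y := by linear_combination -t * this
    rw [h3, hsin, hcos]
    simp
  simp [ht]

/-! ### Coincidences and deck transformations of Penskoi's surfaces. -/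

theorem exp_I_mul_eq_iff {x x' : ℝ} :
    Complex.exp (Complex.I * (x' : ℝ)) = Complex.exp (Complex.I * (x : ℝ)) ↔
      ∃ n : ℤ, x' = x + 2 * π * n := by
  rw [Complex.exp_eq_exp_iff_exists_int]
  refine exists_congr fun n => ?_
  rw [show Complex.I * (x : ℂ) + n * (2 * π * Complex.I)
    = Complex.I * ((x + 2 * π * n : ℝ) : ℂ) by push_cast; ring,
    mul_right_inj' Complex.I_ne_zero, Complex.ofReal_inj]

theorem exp_I_mul_add_pi (x : ℝ) :
    Complex.exp (Complex.I * ((x + π : ℝ) : ℂ)) = -Complex.exp (Complex.I * (x : ℝ)) := by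
  rw [Complex.ofReal_add, mul_add, Complex.exp_add, mul_comm Complex.I (π : ℂ),
    Complex.exp_pi_mul_I]
  ring

theorem penskoi_eq_of_torusRel {a c : ℤ} (hac : (a : ℝ) ^ 2 < (c : ℝ) ^ 2) (k l : ℤ) (p : ℝ × ℝ) :
    penskoi a 0 c (p.1 + 2 * π * k, p.2 + 2 * π * l) = penskoi a 0 c p := by
  have hexp : ∀ b : ℤ, Complex.exp (Complex.I * ((b : ℝ) * (p.1 + 2 * π * k) : ℝ))
      = Complex.exp (Complex.I * ((b : ℝ) * p.1 : ℝ)) := fun b =>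
    exp_I_mul_eq_iff.2 ⟨b * k, by push_cast; ring⟩
  have hy : p.2 + 2 * π * l = p.2 + l * (2 * π) := by ring
  have hs : sin (p.2 + 2 * π * l) = sin p.2 := by rw [hy, sin_add_int_mul_two_pi]
  have hco : cos (p.2 + 2 * π * l) = cos p.2 := by rw [hy, cos_add_int_mul_two_pi]
  ext i
  fin_cases i
  · simp only [Fin.zero_eta, penskoi_zero_apply_zero hac, hexp, hs]
  · simp only [Fin.mk_one, penskoi_zero_apply_one, hco]
  · simp only [Fin.reduceFinMk, penskoi_zero_apply_two, hexp,
      penskoiRadius_congr (congrArg (· ^ 2) hs)]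

/-- An odd multiple of `π` flips the sign of `e^{iax}` for odd `a`, which the sign of `sin (-y)`
cancels. It fixes `e^{icx}` for even `c`, and `cos` and the radius are even in `y`. -/
theorem penskoi_eq_of_glideRel {a c : ℤ} (hac : (a : ℝ) ^ 2 < (c : ℝ) ^ 2) (ha : Odd a)
    (hc : Even c) (k l : ℤ) (p : ℝ × ℝ) :
    penskoi a 0 c (p.1 + π * (2 * k + 1), -p.2 + 2 * π * l) = penskoi a 0 c p := by
  obtain ⟨n, hn⟩ := ha
  obtain ⟨d, hd⟩ := hc
  have hexpa : Complex.exp (Complex.I * ((a : ℝ) * (p.1 + π * (2 * k + 1)) : ℝ))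
      = -Complex.exp (Complex.I * ((a : ℝ) * p.1 : ℝ)) := by
    rw [← exp_I_mul_add_pi]
    exact exp_I_mul_eq_iff.2 ⟨a * k + n, by rw [hn]; push_cast; ring⟩
  have hexpc : Complex.exp (Complex.I * ((c : ℝ) * (p.1 + π * (2 * k + 1)) : ℝ))
      = Complex.exp (Complex.I * ((c : ℝ) * p.1 : ℝ)) :=
    exp_I_mul_eq_iff.2 ⟨c * k + d, by rw [hd]; push_cast; ring⟩
  have hy : -p.2 + 2 * π * l = -p.2 + l * (2 * π) := by ring
  have hs : sin (-p.2 + 2 * π * l) = -sin p.2 := by rw [hy, sin_add_int_mul_two_pi, sin_neg]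
  have hco : cos (-p.2 + 2 * π * l) = cos p.2 := by rw [hy, cos_add_int_mul_two_pi, cos_neg]
  ext i
  fin_cases i
  · simp only [Fin.zero_eta, penskoi_zero_apply_zero hac, hexpa, hs]
    push_cast
    ring
  · simp only [Fin.mk_one, penskoi_zero_apply_one, hco]
  · simp only [Fin.reduceFinMk, penskoi_zero_apply_two, hexpc]
    rw [penskoiRadius_congr (y' := p.2) (by rw [hs, neg_sq])]

/-- Away from the curves `sin y = 0`, coincidences of `penskoi a 0 c` come from translations and,
if `c` is even, glide reflections of the plane. -/
theorem rel_of_penskoi_eq {a c : ℤ} (hac : (a : ℝ) ^ 2 < (c : ℝ) ^ 2) (hcop : IsCoprime a c)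
    {p q : ℝ × ℝ} (hp : sin p.2 ≠ 0) (h : penskoi a 0 c p = penskoi a 0 c q) :
    TorusRel p q ∨ (Even c ∧ GlideRel p q) := by
  have hπ := Real.pi_pos
  have hc2 : (0 : ℝ) < (c : ℝ) ^ 2 := (sq_nonneg _).trans_lt hac
  have h0 := congrArg (fun z : EuclideanSpace ℂ (Fin 3) => z 0) h
  have h1 := congrArg (fun z : EuclideanSpace ℂ (Fin 3) => z 1) h
  have h2 := congrArg (fun z : EuclideanSpace ℂ (Fin 3) => z 2) h
  simp only [penskoi_zero_apply_zero hac, penskoi_zero_apply_one, penskoi_zero_apply_two]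
    at h0 h1 h2
  have hcos : cos p.2 = cos q.2 := by
    have hB : √(((a : ℝ) ^ 2 + (c : ℝ) ^ 2) / (2 * (c : ℝ) ^ 2)) ≠ 0 :=
      (sqrt_pos.2 (by positivity)).ne'
    exact mul_left_cancel₀ hB (Complex.ofReal_injective h1)
  have hrad : penskoiRadius a c p.2 = penskoiRadius a c q.2 :=
    penskoiRadius_congr (by rw [sin_sq, sin_sq, hcos])
  rw [hrad] at h2
  have hexpc := mul_right_cancel₀
    (Complex.ofReal_ne_zero.2 (penskoiRadius_pos hac q.2).ne') h2
  obtain ⟨n, hn⟩ := exp_I_mul_eq_iff.1 hexpc.symm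
  have hr2 : (((√2)⁻¹ : ℝ) : ℂ) ≠ 0 := Complex.ofReal_ne_zero.2 (by positivity)
  simp only [mul_assoc] at h0
  have h0' := mul_left_cancel₀ hr2 h0
  obtain ⟨e, f, hef⟩ := hcop
  have hef' : (e : ℝ) * a + f * c = 1 := by exact_mod_cast hef
  obtain ⟨l, hl | hl⟩ := cos_eq_cos_iff.1 hcos
  · left
    have hs : sin q.2 = sin p.2 := by
      rw [hl, show 2 * (l : ℝ) * π + p.2 = p.2 + l * (2 * π) by ring, sin_add_int_mul_two_pi]
    rw [hs] at h0'
    obtain ⟨k, hk⟩ := exp_I_mul_eq_iff.1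
      (mul_right_cancel₀ (Complex.ofReal_ne_zero.2 hp) h0').symm
    -- Both `a` and `c` times `q.1 - p.1` lie in `2πℤ`; Bézout recovers the difference itself.
    refine ⟨e * k + f * n, l, Prod.ext ?_ ?_⟩
    · push_cast
      linear_combination (p.1 - q.1) * hef' + e * hk + f * hn
    · rw [hl]
      ring
  · right
    have hs : sin q.2 = -sin p.2 := by
      rw [hl, show 2 * (l : ℝ) * π - p.2 = -p.2 + l * (2 * π) by ring, sin_add_int_mul_two_pi,
        sin_neg]
    rw [hs, Complex.ofReal_neg, mul_neg, ← neg_mul, ← exp_I_mul_add_pi] at h0'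
    have hpC : ((sin p.2 : ℝ) : ℂ) ≠ 0 := Complex.ofReal_ne_zero.2 hp
    obtain ⟨k, hk⟩ := exp_I_mul_eq_iff.1 (mul_right_cancel₀ hpC h0')
    -- Now `a (q.1 - p.1)` is an odd and `c (q.1 - p.1)` an even multiple of `π`. Bézout gives `q.1
    -- - p.1 = π N` with `N` an integer, `a N` odd and `c N` even, which forces `N` odd and `c`
    -- even.
    have hx : q.1 = p.1 + π * (2 * (f * n - e * k) - e : ℤ) := by
      push_cast
      linear_combination (p.1 - q.1) * hef' - e * hk + f * hn
    have hc' : c * (2 * (f * n - e * k) - e) = 2 * n := by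
      have : π * ((c * (2 * (f * n - e * k) - e) : ℤ) : ℝ) = π * ((2 * n : ℤ) : ℝ) := by
        rw [hx] at hn
        push_cast at hn ⊢
        linear_combination hn
      exact_mod_cast mul_left_cancel₀ hπ.ne' this
    have ha' : a * (2 * (f * n - e * k) - e) = -2 * k - 1 := by
      have : π * ((a * (2 * (f * n - e * k) - e) : ℤ) : ℝ) = π * ((-2 * k - 1 : ℤ) : ℝ) := by
        rw [hx] at hk
        push_cast at hk ⊢
        linear_combination -hk
      exact_mod_cast mul_left_cancel₀ hπ.ne' this
    have hodd : Odd (2 * (f * n - e * k) - e) := by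
      have : Odd (a * (2 * (f * n - e * k) - e)) := ⟨-k - 1, by rw [ha']; ring⟩
      exact (Int.odd_mul.1 this).2
    refine ⟨?_, ?_⟩
    · have : Even (c * (2 * (f * n - e * k) - e)) := by rw [hc']; exact even_two_mul n
      exact (Int.even_mul.1 this).resolve_right (Int.not_even_iff_odd.2 hodd)
    · obtain ⟨j, hj⟩ := hodd
      rw [hj] at hx
      refine ⟨j, l, Prod.ext ?_ ?_⟩
      · rw [hx]
        push_cast
        ring
      · rw [hl]
        ring

/-- Where `sin y = 0` the first coordinate vanishes and says nothing about `e^{iax}`; these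
parameters must be reached by density. -/
theorem dense_sin_ne_zero : Dense {p : ℝ × ℝ | sin p.2 ≠ 0} := by
  have h : Dense {y : ℝ | sin y ≠ 0} := by
    have : {y : ℝ | sin y = 0} = Set.range fun n : ℤ => (n : ℝ) * π := by
      ext y
      exact sin_eq_zero_iff
    have hcount : {y : ℝ | sin y = 0}.Countable := this ▸ Set.countable_range _
    exact hcount.dense_compl ℝ
  have h2 := (dense_univ (X := ℝ)).prod h
  exact h2.mono fun p hp => hp.2

theorem exists_deck_of_torusRel {a c : ℤ} (hac : (a : ℝ) ^ 2 < (c : ℝ) ^ 2) {p q : ℝ × ℝ}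
    (h : TorusRel p q) : ∃ γ : (ℝ × ℝ) ≃ₜ (ℝ × ℝ), γ p = q ∧
      (∀ x, penskoi a 0 c (γ x) = penskoi a 0 c x) ∧ ContDiff ℝ ∞ γ ∧ ContDiff ℝ ∞ γ.symm := by
  obtain ⟨k, l, rfl⟩ := h
  refine ⟨glide 1 (2 * π * k) (2 * π * l), by simp [glide_apply], fun x => ?_,
    contDiff_glide _ _ _, contDiff_glide_symm _ _ _⟩
  simpa [glide_apply] using penskoi_eq_of_torusRel hac k l x

theorem exists_deck_of_glideRel {a c : ℤ} (hac : (a : ℝ) ^ 2 < (c : ℝ) ^ 2) (ha : Odd a)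
    (hc : Even c) {p q : ℝ × ℝ} (h : GlideRel p q) : ∃ γ : (ℝ × ℝ) ≃ₜ (ℝ × ℝ), γ p = q ∧
      (∀ x, penskoi a 0 c (γ x) = penskoi a 0 c x) ∧ ContDiff ℝ ∞ γ ∧ ContDiff ℝ ∞ γ.symm := by
  obtain ⟨k, l, rfl⟩ := h
  refine ⟨glide (-1) (π * (2 * k + 1)) (2 * π * l), by simp [glide_apply], fun x => ?_,
    contDiff_glide _ _ _, contDiff_glide_symm _ _ _⟩
  simpa [glide_apply] using penskoi_eq_of_glideRel hac ha hc k l x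

theorem sameSheet_penskoi_iff_of_odd {a c : ℤ} (hac : (a : ℝ) ^ 2 < (c : ℝ) ^ 2)
    (hcop : IsCoprime a c) (hc : Odd c) (p q : ℝ × ℝ) :
    SameSheet (penskoi a 0 c) p q ↔ TorusRel p q := by
  constructor
  · refine SameSheet.of_dense isClosed_torusRel dense_sin_ne_zero fun p hp q hpq => ?_
    exact (rel_of_penskoi_eq hac hcop hp hpq).resolve_right
      fun h => Int.not_even_iff_odd.2 hc h.1
  · intro h
    obtain ⟨γ, hγ, hG, -, -⟩ := exists_deck_of_torusRel hac h
    exact SameSheet.of_homeomorph γ hγ hG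

theorem sameSheet_penskoi_iff_of_even {a c : ℤ} (hac : (a : ℝ) ^ 2 < (c : ℝ) ^ 2)
    (hcop : IsCoprime a c) (ha : Odd a) (hc : Even c) (p q : ℝ × ℝ) :
    SameSheet (penskoi a 0 c) p q ↔ TorusRel p q ∨ GlideRel p q := by
  constructor
  · refine SameSheet.of_dense (R := fun p q => TorusRel p q ∨ GlideRel p q)
      (isClosed_torusRel.union isClosed_glideRel) dense_sin_ne_zero fun p hp q hpq => ?_
    exact (rel_of_penskoi_eq hac hcop hp hpq).imp_right And.right
  · rintro (h | h)
    · obtain ⟨γ, hγ, hG, -, -⟩ := exists_deck_of_torusRel hac h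
      exact SameSheet.of_homeomorph γ hγ hG
    · obtain ⟨γ, hγ, hG, -, -⟩ := exists_deck_of_glideRel hac ha hc h
      exact SameSheet.of_homeomorph γ hγ hG

theorem exists_deck_of_sameSheet_penskoi {a c : ℤ} (hac : (a : ℝ) ^ 2 < (c : ℝ) ^ 2)
    (hcop : IsCoprime a c) {p q : ℝ × ℝ} (h : SameSheet (penskoi a 0 c) p q) :
    ∃ γ : (ℝ × ℝ) ≃ₜ (ℝ × ℝ), γ p = q ∧
      (∀ x, penskoi a 0 c (γ x) = penskoi a 0 c x) ∧ ContDiff ℝ ∞ γ ∧ ContDiff ℝ ∞ γ.symm := by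
  rcases Int.even_or_odd c with hc | hc
  · have ha : Odd a := by
      rw [← Int.not_even_iff_odd]
      intro ha
      have := hcop.isUnit_of_dvd' ha.two_dvd hc.two_dvd
      exact absurd (Int.isUnit_iff.1 this) (by decide)
    rcases (sameSheet_penskoi_iff_of_even hac hcop ha hc p q).1 h with h | h
    · exact exists_deck_of_torusRel hac h
    · exact exists_deck_of_glideRel hac ha hc h
  · exact exists_deck_of_torusRel hac ((sameSheet_penskoi_iff_of_odd hac hcop hc p q).1 h)

/-! ### The bipolar Lawson tau-surfaces in Penskoi's coordinates -/

/-- The length of the (unnormalized) normal of the Lawson tau-surface. -/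
def lawsonSpeed (r m v : ℝ) : ℝ := √(r ^ 2 * cos v ^ 2 + m ^ 2 * sin v ^ 2)

theorem sq_cos_add_sq_sin_pos {r m : ℝ} (hr : 0 < r) (hm : 0 < m) (v : ℝ) :
    0 < r * cos v ^ 2 + m * sin v ^ 2 := by
  have h := sin_sq_add_cos_sq v
  rcases eq_or_ne (sin v) 0 with hs | hs
  · have : cos v ^ 2 = 1 := by rw [hs] at h; linarith
    rw [hs, this]
    simpa using hr
  · have : 0 < sin v ^ 2 := by positivity
    positivity

theorem lawsonSpeed_pos {r m : ℝ} (hr : 0 < r) (hm : 0 < m) (v : ℝ) : 0 < lawsonSpeed r m v :=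
  sqrt_pos.2 (sq_cos_add_sq_sin_pos (by positivity) (by positivity) v)

theorem lawsonSpeed_sq {r m : ℝ} (hr : 0 < r) (hm : 0 < m) (v : ℝ) :
    lawsonSpeed r m v ^ 2 = r ^ 2 * cos v ^ 2 + m ^ 2 * sin v ^ 2 :=
  sq_sqrt (sq_cos_add_sq_sin_pos (by positivity) (by positivity) v).le

/-- The tangent of the angle by which `2 v` exceeds the angular parameter of Penskoi's surface. -/
def angleDefectTan (r m v : ℝ) : ℝ :=
  (r - m) * sin v * cos v / (r * cos v ^ 2 + m * sin v ^ 2)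

/-- The second parameter of Penskoi's surface as a function of the second parameter of the bipolar
Lawson tau-surface. -/
def penskoiAngle (r m v : ℝ) : ℝ := π / 2 - (2 * v - arctan (angleDefectTan r m v))

/-- This rests on `(r cos² v + m sin² v)² + (r - m)² sin² v cos² v = r² cos² v + m² sin² v`. -/
theorem sqrt_one_add_angleDefectTan_sq {r m : ℝ} (hr : 0 < r) (hm : 0 < m) (v : ℝ) :
    √(1 + angleDefectTan r m v ^ 2) = lawsonSpeed r m v / (r * cos v ^ 2 + m * sin v ^ 2) := by
  have hD := sq_cos_add_sq_sin_pos hr hm v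
  have hω := lawsonSpeed_pos hr hm v
  rw [sqrt_eq_iff_mul_self_eq (by positivity) (by positivity), ← sq, div_pow,
    lawsonSpeed_sq hr hm, angleDefectTan]
  field_simp
  rw [show sin v ^ 2 = 1 - cos v ^ 2 from sin_sq v]
  ring

theorem cos_arctan_angleDefectTan {r m : ℝ} (hr : 0 < r) (hm : 0 < m) (v : ℝ) :
    cos (arctan (angleDefectTan r m v)) = (r * cos v ^ 2 + m * sin v ^ 2) / lawsonSpeed r m v := by
  rw [cos_arctan, sqrt_one_add_angleDefectTan_sq hr hm, one_div_div]

theorem sin_arctan_angleDefectTan {r m : ℝ} (hr : 0 < r) (hm : 0 < m) (v : ℝ) :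
    sin (arctan (angleDefectTan r m v)) = (r - m) * sin v * cos v / lawsonSpeed r m v := by
  have hD := sq_cos_add_sq_sin_pos hr hm v
  have hω := lawsonSpeed_pos hr hm v
  rw [sin_arctan, sqrt_one_add_angleDefectTan_sq hr hm, angleDefectTan]
  field_simp

/-- The product `(cos v + i sin v)(r cos v + i m sin v)` equals `(r cos² v - m sin² v) + i (r + m)
sin v cos v`. Its argument is `2v` minus the angle defect. That defect is a global `arctan`, because
`(r cos v + i m sin v) e^{-iv}` has positive real part. Hence `penskoiAngle` is `π / 2` minus this
argument. -/
theorem sin_penskoiAngle {r m : ℝ} (hr : 0 < r) (hm : 0 < m) (v : ℝ) :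
    sin (penskoiAngle r m v) = (r * cos v ^ 2 - m * sin v ^ 2) / lawsonSpeed r m v := by
  have hω := lawsonSpeed_pos hr hm v
  rw [penskoiAngle, sin_pi_div_two_sub, cos_sub, cos_arctan_angleDefectTan hr hm,
    sin_arctan_angleDefectTan hr hm, cos_two_mul, sin_two_mul]
  field_simp
  rw [show sin v ^ 2 = 1 - cos v ^ 2 from sin_sq v]
  ring

theorem cos_penskoiAngle {r m : ℝ} (hr : 0 < r) (hm : 0 < m) (v : ℝ) :
    cos (penskoiAngle r m v) = (r + m) * sin v * cos v / lawsonSpeed r m v := by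
  have hω := lawsonSpeed_pos hr hm v
  rw [penskoiAngle, cos_pi_div_two_sub, sin_sub, cos_arctan_angleDefectTan hr hm,
    sin_arctan_angleDefectTan hr hm, cos_two_mul, sin_two_mul]
  field_simp
  rw [show sin v ^ 2 = 1 - cos v ^ 2 from sin_sq v]
  ring

theorem contDiff_penskoiAngle {r m : ℝ} (hr : 0 < r) (hm : 0 < m) :
    ContDiff ℝ ∞ (penskoiAngle r m) := by
  have h : ContDiff ℝ ∞ (angleDefectTan r m) := by
    unfold angleDefectTan
    exact ContDiff.div (by fun_prop) (by fun_prop) fun v => (sq_cos_add_sq_sin_pos hr hm v).ne'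
  exact contDiff_const.sub ((contDiff_const.mul contDiff_id).sub (contDiff_arctan.comp h))

theorem hasDerivAt_penskoiAngle {r m : ℝ} (hr : 0 < r) (hm : 0 < m) (v : ℝ) :
    HasDerivAt (penskoiAngle r m) (-(1 + r * m / lawsonSpeed r m v ^ 2)) v := by
  have hD := sq_cos_add_sq_sin_pos hr hm v
  have hω : 0 < r ^ 2 * cos v ^ 2 + m ^ 2 * sin v ^ 2 :=
    sq_cos_add_sq_sin_pos (by positivity) (by positivity) v
  have hs := hasDerivAt_sin v
  have hc := hasDerivAt_cos v
  have hq := ((hs.const_mul (r - m)).mul hc).div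
    (((hc.pow 2).const_mul r).add ((hs.pow 2).const_mul m)) hD.ne'
  have h := (((hasDerivAt_id v).const_mul 2).sub hq.arctan).const_sub (π / 2)
  refine h.congr_deriv ?_
  have h1 : 1 + ((r - m) * sin v * cos v / (r * cos v ^ 2 + m * sin v ^ 2)) ^ 2
      = (r ^ 2 * cos v ^ 2 + m ^ 2 * sin v ^ 2) / (r * cos v ^ 2 + m * sin v ^ 2) ^ 2 := by
    field_simp
    rw [show sin v ^ 2 = 1 - cos v ^ 2 from sin_sq v]
    ring
  rw [lawsonSpeed_sq hr hm]
  simp only [Pi.mul_apply, Pi.add_apply, Pi.pow_apply, Pi.div_apply]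
  rw [h1]
  -- Here `X / D²` is the derivative of `angleDefectTan` and `W` is the squared speed; the
  -- trigonometry enters only through `X = W - r m`.
  have key : ∀ X D W : ℝ, D ≠ 0 → W ≠ 0 → X = W - r * m →
      -(2 * 1 - 1 / (W / D ^ 2) * (X / D ^ 2)) = -(1 + r * m / W) := by
    rintro X D W hD hW rfl
    field_simp
    ring
  refine key _ _ _ hD.ne' hω.ne' ?_
  push_cast
  linear_combination ((r - m) * (r * cos v ^ 2 - m * sin v ^ 2) - r * m) * sin_sq_add_cos_sq v

theorem exists_homeomorph_penskoiAngle {r m : ℝ} (hr : 0 < r) (hm : 0 < m) :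
    ∃ e : ℝ ≃ₜ ℝ, (∀ v, e v = penskoiAngle r m v) ∧ ContDiff ℝ ∞ e ∧ ContDiff ℝ ∞ e.symm := by
  have hder := hasDerivAt_penskoiAngle hr hm
  have hneg : ∀ v, -(1 + r * m / lawsonSpeed r m v ^ 2) < 0 := fun v => by
    have := lawsonSpeed_pos hr hm v
    have : 0 < 1 + r * m / lawsonSpeed r m v ^ 2 := by positivity
    linarith
  have hanti : StrictAnti (penskoiAngle r m) :=
    strictAnti_of_deriv_neg fun v => by rw [(hder v).deriv]; exact hneg v
  have hcont := (contDiff_penskoiAngle hr hm).continuous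
  have hsurj : Function.Surjective (penskoiAngle r m) := by
    refine hcont.surjective' ?_ ?_
    -- The angle stays within `π / 2` of `π / 2 - 2 v` because `arctan` is bounded.
    · refine Filter.tendsto_atTop_mono (f := fun v => -2 * v) (fun v => ?_) ?_
      · have := neg_pi_div_two_lt_arctan (angleDefectTan r m v)
        rw [penskoiAngle]
        linarith
      · exact Filter.tendsto_id.const_mul_atBot_of_neg (by norm_num)
    · refine Filter.tendsto_atBot_mono (f := fun v => π - 2 * v) (fun v => ?_) ?_
      · have := arctan_lt_pi_div_two (angleDefectTan r m v)
        rw [penskoiAngle]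
        linarith
      · exact Filter.tendsto_atBot_add_const_left _ π
          (Filter.tendsto_neg_atTop_atBot.comp (Filter.tendsto_id.const_mul_atTop two_pos))
  have hmono : StrictMono fun v => penskoiAngle r m (-v) := fun a b hab => hanti (neg_lt_neg hab)
  have hsurj' : Function.Surjective fun v => penskoiAngle r m (-v) :=
    hsurj.comp neg_surjective
  let e : ℝ ≃ₜ ℝ := (Homeomorph.neg ℝ).trans (hmono.orderIsoOfSurjective _ hsurj').toHomeomorph
  have he : ∀ v, e v = penskoiAngle r m v := fun v => by
    change penskoiAngle r m (-(-v)) = _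
    rw [neg_neg]
  have he' : ⇑e = penskoiAngle r m := funext he
  refine ⟨e, he, he' ▸ contDiff_penskoiAngle hr hm, ?_⟩
  exact e.contDiff_symm_deriv (fun v => (hneg v).ne) (fun v => he' ▸ hder v)
    (he' ▸ contDiff_penskoiAngle hr hm)

/-- The linear map of `Λ²ℝ⁴` onto `ℂ³` that carries the bipolar Lawson tau-surface to Penskoi's
surface. -/
def bivectorToComplex (r m : ℝ) : EuclideanSpace ℝ (Fin 6) →ₗ[ℝ] EuclideanSpace ℂ (Fin 3) where
  -- On the bipolar surface the outer entries rotate with frequencies `r - m` and `r + m` in `u`.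
  -- The pair `(z 0, z 1)` is a multiple of `(-m, r)`, which the middle entry rotates onto the real
  -- axis.
  toFun z := !₂[⟨(√2)⁻¹ * (z 5 - z 4), (√2)⁻¹ * (z 3 + z 2)⟩,
    ⟨(√(r ^ 2 + m ^ 2))⁻¹ * (r * z 1 - m * z 0), (√(r ^ 2 + m ^ 2))⁻¹ * (r * z 0 + m * z 1)⟩,
    ⟨(√2)⁻¹ * (z 5 + z 4), (√2)⁻¹ * (z 3 - z 2)⟩]
  map_add' z w := by
    ext i
    fin_cases i <;> apply Complex.ext <;> simp <;> ring
  map_smul' t z := by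
    ext i
    fin_cases i <;> apply Complex.ext <;> simp <;> ring

theorem norm_bivectorToComplex {r m : ℝ} (hr : 0 < r) (z : EuclideanSpace ℝ (Fin 6)) :
    ‖bivectorToComplex r m z‖ = ‖z‖ := by
  have h2 : (√2)⁻¹ ^ 2 = (2 : ℝ)⁻¹ := by rw [inv_pow, sq_sqrt (by norm_num)]
  have hrm : 0 < r ^ 2 + m ^ 2 := by positivity
  have h3 : (√(r ^ 2 + m ^ 2))⁻¹ ^ 2 = (r ^ 2 + m ^ 2)⁻¹ := by rw [inv_pow, sq_sqrt hrm.le]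
  rw [EuclideanSpace.norm_eq, EuclideanSpace.norm_eq]
  congr 1
  simp only [Fin.sum_univ_succ, Complex.sq_norm, Complex.normSq_apply, bivectorToComplex,
    norm_eq_abs, sq_abs]
  simp
  have h4 : (r ^ 2 + m ^ 2)⁻¹ * (r ^ 2 + m ^ 2) = 1 := inv_mul_cancel₀ hrm.ne'
  -- Only the squares of the two normalizing factors matter from here on.
  generalize (√2)⁻¹ = s at *
  generalize (√(r ^ 2 + m ^ 2))⁻¹ = t at *
  linear_combination 2 * (z 2 ^ 2 + z 3 ^ 2 + z 4 ^ 2 + z 5 ^ 2) * h2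
    + (z 0 ^ 2 + z 1 ^ 2) * ((r ^ 2 + m ^ 2) * h3 + h4)

/-- `bivectorToComplex` as a linear isometry of `Λ²ℝ⁴ ≅ ℝ⁶` onto `ℂ³`. -/
def bivectorIsometry {r : ℝ} (m : ℝ) (hr : 0 < r) :
    EuclideanSpace ℝ (Fin 6) ≃ₗᵢ[ℝ] EuclideanSpace ℂ (Fin 3) :=
  LinearIsometry.toLinearIsometryEquiv
    ⟨bivectorToComplex r m, norm_bivectorToComplex hr⟩ (by
      rw [finrank_euclideanSpace_fin,
        (WithLp.linearEquiv 2 ℝ (Fin 3 → ℂ)).finrank_eq, Module.finrank_pi_fintype]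
      simp)

theorem bivectorIsometry_apply {r : ℝ} (m : ℝ) (hr : 0 < r) (z : EuclideanSpace ℝ (Fin 6)) :
    bivectorIsometry m hr z = bivectorToComplex r m z := rfl

/-- The coefficients are homogeneous of degree zero in `(a, c)`, so `k` cancels; the rest is an
identity between squares of positive numbers. -/
theorem penskoiRadius_penskoiAngle {r m k : ℝ} (hr : 0 < r) (hm : 0 < m) (hk : k ≠ 0) (v : ℝ) :
    penskoiRadius ((r - m) / k) ((r + m) / k) (penskoiAngle r m v) =
      (√2)⁻¹ * ((r * cos v ^ 2 + m * sin v ^ 2) / lawsonSpeed r m v) := by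
  have hD := sq_cos_add_sq_sin_pos hr hm v
  have hω := lawsonSpeed_pos hr hm v
  have hrm : 0 < r * m := mul_pos hr hm
  have hk2 : 0 < k ^ 2 := by positivity
  have h1 : (((r - m) / k) ^ 2 - ((r + m) / k) ^ 2) / (2 * (-((r + m) / k) ^ 2))
      = 2 * (r * m) / (r + m) ^ 2 := by
    field_simp
    ring
  have h2 : ((r - m) / k) ^ 2 / (((r + m) / k) ^ 2 - ((r - m) / k) ^ 2)
      = (r - m) ^ 2 / (4 * (r * m)) := by
    rw [show ((r + m) / k) ^ 2 - ((r - m) / k) ^ 2 = 4 * (r * m) / k ^ 2 by field_simp; ring]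
    field_simp
  rw [penskoiRadius, h1, h2, ← sqrt_mul (by positivity), ← sqrt_inv,
    ← sqrt_sq (div_pos hD hω).le, ← sqrt_mul (by positivity), sin_sq, cos_penskoiAngle hr hm]
  congr 1
  rw [div_pow, div_pow, lawsonSpeed_sq hr hm]
  have hω2 : 0 < r ^ 2 * cos v ^ 2 + m ^ 2 * sin v ^ 2 :=
    sq_cos_add_sq_sin_pos (by positivity) (by positivity) v
  field_simp
  rw [show sin v ^ 2 = 1 - cos v ^ 2 from sin_sq v]
  ring

theorem exp_I_mul_eq_mk (x : ℝ) : Complex.exp (Complex.I * (x : ℝ)) = ⟨cos x, sin x⟩ := by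
  rw [mul_comm]
  exact Complex.ext (Complex.exp_ofReal_mul_I_re x) (Complex.exp_ofReal_mul_I_im x)

theorem bivectorToComplex_bipolarLawson {r m k : ℝ} (hm : 0 < m) (hmr : m < r) (hk : k ≠ 0)
    (p : ℝ × ℝ) :
    bivectorToComplex r m (bipolarLawson r m p) =
      penskoi ((r - m) / k) 0 ((r + m) / k) (k * p.1, penskoiAngle r m p.2) := by
  obtain ⟨u, v⟩ := p
  have hr : 0 < r := hm.trans hmr
  have hω := lawsonSpeed_pos hr hm v
  have hk2 : 0 < k ^ 2 := by positivity
  have hac : ((r - m) / k) ^ 2 < ((r + m) / k) ^ 2 := by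
    rw [div_pow, div_pow]
    have := mul_pos hr hm
    gcongr
    nlinarith
  have ha : (r - m) / k * (k * u) = r * u - m * u := by field_simp
  have hc : (r + m) / k * (k * u) = r * u + m * u := by field_simp
  have hsu : sin (r * u) ^ 2 = 1 - cos (r * u) ^ 2 := sin_sq _
  have hsm : sin (m * u) ^ 2 = 1 - cos (m * u) ^ 2 := sin_sq _
  have hB : √((((r - m) / k) ^ 2 + ((r + m) / k) ^ 2) / (2 * ((r + m) / k) ^ 2))
      = √(r ^ 2 + m ^ 2) / (r + m) := by
    rw [sqrt_eq_iff_mul_self_eq (by positivity) (by positivity), ← sq,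
      div_pow √(r ^ 2 + m ^ 2), sq_sqrt (by positivity)]
    field_simp
    ring
  have hrm : √(r ^ 2 + m ^ 2) ^ 2 = r ^ 2 + m ^ 2 := sq_sqrt (by positivity)
  have hrm0 : 0 < √(r ^ 2 + m ^ 2) := sqrt_pos.2 (by positivity)
  have hω0 : √(r ^ 2 * cos v ^ 2 + m ^ 2 * sin v ^ 2) = lawsonSpeed r m v := rfl
  ext i
  fin_cases i
  · simp only [Fin.zero_eta, penskoi_zero_apply_zero hac, ha, exp_I_mul_eq_mk,
      sin_penskoiAngle hr hm, cos_sub, sin_sub]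
    apply Complex.ext <;>
      simp only [bivectorToComplex, bipolarLawson, wedge, lawson, lawsonNormal, hω0] <;>
      simp [-Complex.ofReal_div, -Complex.ofReal_mul, -Complex.ofReal_inv, -Complex.ofReal_sin,
        -Complex.ofReal_cos] <;>
      field_simp <;>
      ring
  · simp only [Fin.mk_one, penskoi_zero_apply_one, hB, cos_penskoiAngle hr hm]
    apply Complex.ext <;>
      simp only [bivectorToComplex, bipolarLawson, wedge, lawson, lawsonNormal, hω0] <;>
      simp [-Complex.ofReal_div, -Complex.ofReal_mul, -Complex.ofReal_inv, -Complex.ofReal_sin,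
        -Complex.ofReal_cos] <;>
      field_simp
    · linear_combination sin v * cos v * (r ^ 2 * hsm + m ^ 2 * hsu - hrm)
    · right
      linear_combination r * m * sin v * cos v * (hsm - hsu)
  · simp only [Fin.reduceFinMk, penskoi_zero_apply_two, hc, exp_I_mul_eq_mk,
      penskoiRadius_penskoiAngle hr hm hk, cos_add, sin_add]
    apply Complex.ext <;>
      simp only [bivectorToComplex, bipolarLawson, wedge, lawson, lawsonNormal, hω0] <;>
      simp [-Complex.ofReal_div, -Complex.ofReal_mul, -Complex.ofReal_inv, -Complex.ofReal_sin,
        -Complex.ofReal_cos] <;>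
      field_simp <;>
      ring

theorem isometricSurfaces_bipolarLawson_penskoi {r m k : ℝ} (hm : 0 < m) (hmr : m < r)
    (hk : k ≠ 0) {a c : ℤ} (ha : (a : ℝ) = (r - m) / k) (hc : (c : ℝ) = (r + m) / k)
    (hcop : IsCoprime a c) :
    IsometricSurfaces (bipolarLawson r m) (penskoi a 0 c) := by
  have hr : 0 < r := hm.trans hmr
  have hac : (a : ℝ) ^ 2 < (c : ℝ) ^ 2 := by
    have := mul_pos hr hm
    have hk2 : 0 < k ^ 2 := by positivity
    rw [ha, hc, div_pow, div_pow]
    gcongr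
    nlinarith
  obtain ⟨e, he, he1, he2⟩ := exists_homeomorph_penskoiAngle hr hm
  let Ψ : (ℝ × ℝ) ≃ₜ (ℝ × ℝ) := (Homeomorph.mulLeft₀ k hk).prodCongr e
  have hΨ : ContDiff ℝ ∞ Ψ :=
    (contDiff_const.mul contDiff_fst).prodMk (he1.comp contDiff_snd)
  have hΨ' : ContDiff ℝ ∞ Ψ.symm :=
    (contDiff_const.mul contDiff_fst).prodMk (he2.comp contDiff_snd)
  refine isometricSurfaces_of_comp (isImmersionOfPlane_penskoi hac) (bivectorIsometry m hr) Ψ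
    hΨ hΨ' (fun p => ?_) fun p q h => exists_deck_of_sameSheet_penskoi hac hcop h
  rw [bivectorIsometry_apply, bivectorToComplex_bipolarLawson hm hmr hk, ha, hc, ← he]
  rfl

theorem isPenskoiTriple_zero {a c : ℤ} (hac : (a : ℝ) ^ 2 < (c : ℝ) ^ 2) :
    IsPenskoiTriple a 0 c := by
  refine Or.inl ⟨a, 0, c, rfl, by simp, rfl, ?_⟩
  rw [← sqrt_sq_eq_abs]
  exact sqrt_lt_sqrt (by positivity) (by simpa using hac)

theorem IsometricSurfaces.isTorus {V W : Type*} [NormedAddCommGroup V] [InnerProductSpace ℝ V]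
    [NormedAddCommGroup W] [InnerProductSpace ℝ W] {F : ℝ × ℝ → V} {G : ℝ × ℝ → W}
    (h : IsometricSurfaces F G) (hG : IsTorus G) : IsTorus F :=
  ⟨h.2.2.choose.trans hG.some⟩

theorem IsometricSurfaces.isKleinBottle {V W : Type*} [NormedAddCommGroup V]
    [InnerProductSpace ℝ V] [NormedAddCommGroup W] [InnerProductSpace ℝ W] {F : ℝ × ℝ → V}
    {G : ℝ × ℝ → W} (h : IsometricSurfaces F G) (hG : IsKleinBottle G) : IsKleinBottle F :=
  ⟨h.2.2.choose.trans hG.some⟩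

end TauSurface

end

/-! ### Arithmetic of the parameters and the three cases. -/

/-- Modulo `r + m`, `r - m` is `-2m`, and both `2` and `m` are coprime to `r + m`. -/
theorem TauSurface.isCoprime_sub_add {r m : ℤ} (h : IsCoprime r m) (hodd : Odd (r + m)) :
    IsCoprime (r - m) (r + m) := by
  have h2 : IsCoprime 2 (r + m) := Int.isCoprime_two_left.2 hodd
  have h3 : IsCoprime m (r + m) := by simpa using h.symm.add_mul_left_right 1
  rw [show r - m = -(2 * m) + 1 * (r + m) by ring]
  exact (h2.mul_left h3).neg_left.add_mul_right_left 1

/-- The product is `c² - a²`, and squares are 0 or 1 mod 4 according to parity. Applied to `r = c +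
a`, `m = c - a`, this ties `rm` mod 4 to the parity of `c`. -/
theorem TauSurface.sub_mul_add_emod_four_of_even {a c : ℤ} (ha : Odd a) (hc : Even c) :
    (c + a) * (c - a) % 4 = 3 := by
  obtain ⟨i, rfl⟩ := ha
  obtain ⟨d, rfl⟩ := hc
  rw [show (d + d + (2 * i + 1)) * (d + d - (2 * i + 1)) = 4 * (d ^ 2 - i ^ 2 - i - 1) + 3 by ring]
  omega

theorem TauSurface.sub_mul_add_emod_four_of_odd {a c : ℤ} (ha : Even a) (hc : Odd c) :
    (c + a) * (c - a) % 4 = 1 := by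
  obtain ⟨i, rfl⟩ := ha
  obtain ⟨d, rfl⟩ := hc
  rw [show (2 * d + 1 + (i + i)) * (2 * d + 1 - (i + i)) = 4 * (d ^ 2 + d - i ^ 2) + 1 by ring]
  omega

theorem TauSurface.isCoprime_of_add_of_sub {r m a c : ℤ} (h : IsCoprime r m) (hr : c + a = r)
    (hm : c - a = m) : IsCoprime a c := by
  obtain ⟨x, y, hxy⟩ := h
  -- `x (c + a) + y (c - a) = (x - y) a + (x + y) c`.
  exact ⟨x - y, x + y, by rw [← hxy, ← hr, ← hm]; ring⟩

theorem theorem1 (r m : ℕ) (hm : 0 < m) (hmr : m < r) (hcop : Nat.Coprime r m) :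
    (r * m ≡ 0 [MOD 2] →
      TauSurface.IsTorus (TauSurface.bipolarLawson r m) ∧
      TauSurface.IsPenskoiTriple ((r : ℝ) - m) 0 ((r : ℝ) + m) ∧
      TauSurface.IsometricSurfaces (TauSurface.bipolarLawson r m)
        (TauSurface.penskoi ((r : ℝ) - m) 0 ((r : ℝ) + m))) ∧
    (r * m ≡ 1 [MOD 4] →
      TauSurface.IsTorus (TauSurface.bipolarLawson r m) ∧
      TauSurface.IsPenskoiTriple (((r : ℝ) - m) / 2) 0 (((r : ℝ) + m) / 2) ∧
      TauSurface.IsometricSurfaces (TauSurface.bipolarLawson r m)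
        (TauSurface.penskoi (((r : ℝ) - m) / 2) 0 (((r : ℝ) + m) / 2))) ∧
    (r * m ≡ 3 [MOD 4] →
      TauSurface.IsKleinBottle (TauSurface.bipolarLawson r m) ∧
      TauSurface.IsPenskoiTriple (((r : ℝ) - m) / 2) 0 (((r : ℝ) + m) / 2) ∧
      TauSurface.IsometricSurfaces (TauSurface.bipolarLawson r m)
        (TauSurface.penskoi (((r : ℝ) - m) / 2) 0 (((r : ℝ) + m) / 2))) := by
  have hm' : (0 : ℝ) < m := by exact_mod_cast hm
  have hmr' : (m : ℝ) < r := by exact_mod_cast hmr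
  have hcopZ : IsCoprime (r : ℤ) (m : ℤ) := Nat.isCoprime_iff_coprime.2 hcop
  have hlt : ∀ {a c : ℤ} {k : ℝ}, k ≠ 0 → (a : ℝ) = (r - m) / k → (c : ℝ) = (r + m) / k →
      (a : ℝ) ^ 2 < (c : ℝ) ^ 2 := by
    intro a c k hk ha hc
    have := mul_pos (hm'.trans hmr') hm'
    have hk2 : 0 < k ^ 2 := by positivity
    rw [ha, hc, div_pow, div_pow]
    gcongr
    nlinarith
  have hparity : Odd (r * m) → ∀ a c : ℤ, (r : ℤ) = c + a → (Odd c ↔ Even a) := by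
    intro hodd a c hra
    have hr : Odd (c + a) := by
      rw [← hra]
      exact_mod_cast (Nat.odd_mul.1 hodd).1
    exact Int.odd_add.1 hr
  have hhalf : Odd (r * m) → ∃ a c : ℤ, (r : ℤ) = c + a ∧ (m : ℤ) = c - a ∧
      (a : ℝ) = ((r : ℝ) - m) / 2 ∧ (c : ℝ) = ((r : ℝ) + m) / 2 ∧ IsCoprime a c := by
    intro hodd
    obtain ⟨⟨i, hi⟩, ⟨j, hj⟩⟩ := Nat.odd_mul.1 hodd
    refine ⟨i - j, i + j + 1, by omega, by omega, ?_, ?_,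
      TauSurface.isCoprime_of_add_of_sub hcopZ (by omega) (by omega)⟩
    · rw [hi, hj]
      push_cast
      ring
    · rw [hi, hj]
      push_cast
      ring
  refine ⟨fun h => ?_, fun h => ?_, fun h => ?_⟩
  · have hodd : Odd ((r : ℤ) + m) := by
      have heven : Even (r * m) := Nat.even_iff.2 h
      have : ¬ (Even r ∧ Even m) := fun hrm => by
        have := Nat.dvd_gcd hrm.1.two_dvd hrm.2.two_dvd
        rw [hcop] at this
        omega
      have hsum : Odd (r + m) := by
        rw [Nat.odd_add]
        rw [Nat.even_mul] at heven
        rw [← Nat.not_even_iff_odd]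
        tauto
      exact_mod_cast hsum
    -- The scale is `k = 1`: `r + m` is odd, so no halving is possible.
    have ha : (((r : ℤ) - m : ℤ) : ℝ) = ((r : ℝ) - m) / 1 := by push_cast; ring
    have hc : (((r : ℤ) + m : ℤ) : ℝ) = ((r : ℝ) + m) / 1 := by push_cast; ring
    have hcop' := TauSurface.isCoprime_sub_add hcopZ hodd
    have hlt' := hlt one_ne_zero ha hc
    have hiso := TauSurface.isometricSurfaces_bipolarLawson_penskoi hm' hmr' one_ne_zero ha hc hcop'
    have htri := TauSurface.isPenskoiTriple_zero hlt'
    have htor := hiso.isTorus (TauSurface.isTorus_of_sameSheet_iff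
      (TauSurface.sameSheet_penskoi_iff_of_odd hlt' hcop' hodd))
    push_cast at hiso htri
    exact ⟨htor, htri, hiso⟩
  · have hodd : Odd (r * m) := Nat.odd_iff.2 (by
      unfold Nat.ModEq at h
      omega)
    obtain ⟨a, c, hra, hmc, ha, hc, hcop'⟩ := hhalf hodd
    have hlt' := hlt two_ne_zero ha hc
    have hiso := TauSurface.isometricSurfaces_bipolarLawson_penskoi hm' hmr' two_ne_zero ha hc hcop'
    have htri := TauSurface.isPenskoiTriple_zero hlt'
    -- An even `c` would make `a` odd and `rm = c² - a²` congruent to 3 mod 4.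
    have hcodd : Odd c := by
      by_contra hc'
      have ha' : Odd a := by
        rw [← Int.not_even_iff_odd, ← hparity hodd a c hra]
        exact hc'
      have h3 := TauSurface.sub_mul_add_emod_four_of_even ha' (Int.not_odd_iff_even.1 hc')
      have h1 : ((r : ℤ) * m) % 4 = 1 := by exact_mod_cast h
      rw [hra, hmc, h3] at h1
      omega
    have htor := hiso.isTorus (TauSurface.isTorus_of_sameSheet_iff
      (TauSurface.sameSheet_penskoi_iff_of_odd hlt' hcop' hcodd))
    rw [ha, hc] at hiso htri
    exact ⟨htor, htri, hiso⟩
  · have hodd : Odd (r * m) := Nat.odd_iff.2 (by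
      unfold Nat.ModEq at h
      omega)
    obtain ⟨a, c, hra, hmc, ha, hc, hcop'⟩ := hhalf hodd
    have hlt' := hlt two_ne_zero ha hc
    have hiso := TauSurface.isometricSurfaces_bipolarLawson_penskoi hm' hmr' two_ne_zero ha hc hcop'
    have htri := TauSurface.isPenskoiTriple_zero hlt'
    have hceven : Even c := by
      by_contra hc'
      rw [Int.not_even_iff_odd] at hc'
      have h1 := TauSurface.sub_mul_add_emod_four_of_odd ((hparity hodd a c hra).1 hc') hc'
      have h3 : ((r : ℤ) * m) % 4 = 3 := by exact_mod_cast h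
      rw [hra, hmc, h1] at h3
      omega
    have haodd : Odd a := by
      rw [← Int.not_even_iff_odd, ← hparity hodd a c hra, Int.not_odd_iff_even]
      exact hceven
    have hklein := hiso.isKleinBottle (TauSurface.isKleinBottle_of_sameSheet_iff
      (TauSurface.sameSheet_penskoi_iff_of_even hlt' hcop' haodd hceven))
    rw [ha, hc] at hiso htri
    exact ⟨hklein, htri, hiso⟩
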